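/- Let $(\zeta_k)_{k\ge 0}$ be independent standard complex Gaussian random variables on a probability space (each $\zeta_k\sim N_{\mathbb C}(0,1)$, i.e. its real and imaginary parts are independent centered real Gaussians of variance $\tfrac12$). Let $$f_0(z)=\sum_{k=0}^\infty \zeta_k\frac{z^k}{\sqrt{k!}},\qquad f_n(z,\bar z)=\frac{1}{\sqrt{n!}}\,(\partial_z-\bar z)^n f_0(z)\quad (n\ge 0,\ z\in\mathbb C),$$ where $\partial_z=\tfrac12(\partial_x-i\,\partial_y)$ for $z=x+iy$, and set $$S_N(z)=\frac1N\sum_{n=0}^{N-1}\bigl|e^{-|z|^2/2}f_n(z,\bar z)\bigr|^2 .$$ Then for every compact set $K\subset\mathbb C$, almost surely the functions $S_N$ are continuous on $K$ and $S_N\to 1$ in $C(K)$, i.e. $$\sup_{z\in K}|S_N(z)-1|\to 0\quad\text{almost surely, as } N\to\infty .$$ -/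

import Mathlib

open MeasureTheory ProbabilityTheory Filter Topology

noncomputable section

/-- The standard complex Gaussian law `N_ℂ(0,1)`: the real and imaginary parts are independent
centered real Gaussians of variance `1/2`. -/
def stdComplexGaussian : Measure ℂ :=
  ((gaussianReal 0 (1 / 2)).prod (gaussianReal 0 (1 / 2))).map
    (fun p : ℝ × ℝ => (p.1 : ℂ) + (p.2 : ℂ) * Complex.I)

/-- The Wirtinger derivative `∂_z = (∂_x - i ∂_y) / 2`. -/
def wirtingerDeriv (F : ℂ → ℂ) (z : ℂ) : ℂ :=
  (1 / 2) * (fderiv ℝ F z 1 - Complex.I * fderiv ℝ F z Complex.I)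

/-- The Landau level raising operator `∂_z - z̄`. -/
def landauRaising (F : ℂ → ℂ) (z : ℂ) : ℂ :=
  wirtingerDeriv F z - (starRingEnd ℂ) z * F z

/-- The power series `f₀(z) = ∑ₖ aₖ zᵏ / √(k!)`. -/
def gefSeries (a : ℕ → ℂ) (z : ℂ) : ℂ :=
  ∑' k : ℕ, a k * (z ^ k / (Real.sqrt (k.factorial : ℝ) : ℂ))

/-- `fₙ(z, z̄) = (n!)^{-1/2} (∂_z - z̄)ⁿ f₀(z)`. -/
def landauField (a : ℕ → ℂ) (n : ℕ) (z : ℂ) : ℂ :=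
  (1 / (Real.sqrt (n.factorial : ℝ) : ℂ)) * (landauRaising^[n] (gefSeries a)) z

/-- `S_N(z) = N⁻¹ ∑_{n < N} |e^{-|z|²/2} fₙ(z, z̄)|²`. -/
def averagedField (a : ℕ → ℂ) (N : ℕ) (z : ℂ) : ℝ :=
  (1 / (N : ℝ)) * ∑ n ∈ Finset.range N,
    ‖(Real.exp (-‖z‖ ^ 2 / 2) : ℂ) * landauField a n z‖ ^ 2

end

/-!
Along a ray `t ↦ t z` the weighted levels `hₙ = e^{-|z|²/2} fₙ` solve the ladder equations
`hₙ' = z √(n+1) hₙ₊₁ - z̄ √n hₙ₋₁`, whose coefficients are skew-adjoint. Hence the mass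
`∑_{n < N} |hₙ|²` changes only by the flux through level `N`, which is `O(√N)` times
`|h_{N-1}|² + |h_N|²`. Averaging over `N` in a window of width between the orders `√N` and `N` makes
the total change negligible compared with `N`, provided that the mass is `O(N)` all along the ray.
This a priori bound comes from the same averaging over the window from `N` to `2 N`, applied
repeatedly to Taylor polynomials. So the Cesàro means of `|hₙ|²` at `z` and at `0` have the same
limit, locally uniformly in `z`. At `0` the levels are the coefficients `ζₙ`, and the strong law of
large numbers applies.
-/

/-- `F` is real differentiable at `z` with Wirtinger derivatives `∂F/∂z = p` and `∂F/∂z̄ = q`. -/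
def HasWirtingerAt (F : ℂ → ℂ) (p q z : ℂ) : Prop :=
  HasFDerivAt F (p • ContinuousLinearMap.id ℝ ℂ + q • (Complex.conjCLE : ℂ →L[ℝ] ℂ)) z

section Wirtinger

variable {F G : ℂ → ℂ} {p p' q q' z : ℂ}

theorem hasWirtingerAt_of_hasDerivAt (h : HasDerivAt F p z) : HasWirtingerAt F p 0 z := by
  refine (h.hasFDerivAt.restrictScalars ℝ).congr_fderiv ?_
  ext x
  simp [mul_comm]

theorem hasWirtingerAt_conj (z : ℂ) : HasWirtingerAt (starRingEnd ℂ) 0 1 z := by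
  refine ((Complex.conjCLE : ℂ →L[ℝ] ℂ).hasFDerivAt (x := z)).congr_fderiv ?_
  module

namespace HasWirtingerAt

theorem wirtingerDeriv_eq (h : HasWirtingerAt F p q z) : wirtingerDeriv F z = p := by
  rw [wirtingerDeriv, HasFDerivAt.fderiv h]
  simp only [add_apply, smul_apply, ContinuousLinearMap.id_apply, ContinuousLinearEquiv.coe_coe,
    Complex.conjCLE_apply, map_one, Complex.conj_I, smul_eq_mul]
  linear_combination (q - p) / 2 * Complex.I_sq

theorem sub (hF : HasWirtingerAt F p q z) (hG : HasWirtingerAt G p' q' z) :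
    HasWirtingerAt (fun x => F x - G x) (p - p') (q - q') z := by
  refine (HasFDerivAt.fun_sub hF hG).congr_fderiv ?_
  module

theorem mul (hF : HasWirtingerAt F p q z) (hG : HasWirtingerAt G p' q' z) :
    HasWirtingerAt (fun x => F x * G x) (p * G z + F z * p') (q * G z + F z * q') z := by
  refine (HasFDerivAt.fun_mul hF hG).congr_fderiv ?_
  module

theorem const_mul (c : ℂ) (h : HasWirtingerAt F p q z) :
    HasWirtingerAt (fun x => c * F x) (c * p) (c * q) z := by
  refine (HasFDerivAt.const_mul h c).congr_fderiv ?_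
  module

theorem cexp (h : HasWirtingerAt F p q z) :
    HasWirtingerAt (fun x => Complex.exp (F x)) (Complex.exp (F z) * p) (Complex.exp (F z) * q)
      z := by
  refine (HasFDerivAt.cexp h).congr_fderiv ?_
  module

theorem hasDerivAt_comp_ofReal_mul {t : ℝ} {w : ℂ} (h : HasWirtingerAt F p q (t * w)) :
    HasDerivAt (fun s : ℝ => F (s * w)) (p * w + q * (starRingEnd ℂ) w) t := by
  have hray : HasDerivAt (fun s : ℝ => (s : ℂ) * w) w t := by
    simpa using (hasDerivAt_id t).ofReal_comp.mul_const w
  simpa [Function.comp_def] using HasFDerivAt.comp_hasDerivAt_of_eq t h hray rfl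

end HasWirtingerAt

end Wirtinger

section Raising

variable {F : ℂ → ℂ}

theorem hasWirtingerAt_iterate_landauRaising (hF : Differentiable ℂ F) (n : ℕ) (z : ℂ) :
    HasWirtingerAt (landauRaising^[n] F) (landauRaising^[n] (deriv F) z)
      (-(n * landauRaising^[n - 1] F z)) z := by
  induction n using Nat.strong_induction_on generalizing F z with
  | _ n ih =>
  have hrec : ∀ m < n, ∀ {G : ℂ → ℂ}, Differentiable ℂ G → ∀ x, landauRaising^[m + 1] G x =
      landauRaising^[m] (deriv G) x - (starRingEnd ℂ) x * landauRaising^[m] G x := by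
    intro m hm G hG x
    rw [Function.iterate_succ_apply', landauRaising, (ih m hm hG x).wirtingerDeriv_eq]
  rcases n with _ | n
  · simpa using hasWirtingerAt_of_hasDerivAt (hF z).hasDerivAt
  have hn := n.lt_succ_self
  rw [funext (hrec n hn hF), hrec n hn hF.deriv z]
  convert (ih n hn hF.deriv z).sub ((hasWirtingerAt_conj z).mul (ih n hn hF z)) using 1
  · ring
  · rcases n with _ | m
    · simp
    · simp only [Nat.add_sub_cancel]
      push_cast
      linear_combination (-(m + 1) : ℂ) * hrec m (by omega) hF z

theorem iterate_landauRaising_succ (hF : Differentiable ℂ F) (n : ℕ) (z : ℂ) :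
    landauRaising^[n + 1] F z =
      landauRaising^[n] (deriv F) z - (starRingEnd ℂ) z * landauRaising^[n] F z := by
  rw [Function.iterate_succ_apply', landauRaising,
    (hasWirtingerAt_iterate_landauRaising hF n z).wirtingerDeriv_eq]

theorem iterate_landauRaising_apply_zero (hF : Differentiable ℂ F) (n : ℕ) :
    landauRaising^[n] F 0 = iteratedDeriv n F 0 := by
  induction n generalizing F with
  | zero => simp
  | succ n ih => simp [iterate_landauRaising_succ hF, ih hF.deriv, iteratedDeriv_succ']

end Raising

/-- The `n`-th Landau level `e^{-|z|²/2} (n!)^{-1/2} (∂_z - z̄)ⁿ F (z)` generated by `F`, in the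
weighted form that makes the raising and lowering operators adjoint to each other. -/
noncomputable def weightedLevel (F : ℂ → ℂ) (z : ℂ) (n : ℕ) : ℂ :=
  (Real.exp (-‖z‖ ^ 2 / 2) : ℂ) * ((1 / (Real.sqrt n.factorial : ℂ)) * landauRaising^[n] F z)

section WeightedLevel

variable {F : ℂ → ℂ}

theorem norm_weightedLevel_le (F : ℂ → ℂ) (z : ℂ) (n : ℕ) :
    ‖weightedLevel F z n‖ ≤ ‖landauRaising^[n] F z‖ / √n.factorial := by
  have hexp : Real.exp (-‖z‖ ^ 2 / 2) ≤ 1 :=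
    Real.exp_le_one_iff.2 (by linarith [sq_nonneg ‖z‖])
  rw [weightedLevel, norm_mul, norm_mul, norm_div, norm_one, Complex.norm_real, Complex.norm_real,
    Real.norm_of_nonneg (Real.exp_nonneg _), Real.norm_of_nonneg (Real.sqrt_nonneg _),
    one_div_mul_eq_div]
  exact mul_le_of_le_one_left (by positivity) hexp

theorem norm_weightedLevel_zero (F : ℂ → ℂ) (n : ℕ) :
    ‖weightedLevel F 0 n‖ = ‖landauRaising^[n] F 0‖ / √n.factorial := by
  simp [weightedLevel, div_eq_inv_mul, Real.norm_of_nonneg (Real.sqrt_nonneg _)]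

theorem hasWirtingerAt_exp_neg_norm_sq (z : ℂ) :
    HasWirtingerAt (fun x => (Real.exp (-‖x‖ ^ 2 / 2) : ℂ))
      (-((starRingEnd ℂ) z / 2) * Real.exp (-‖z‖ ^ 2 / 2)) (-(z / 2) * Real.exp (-‖z‖ ^ 2 / 2))
      z := by
  have hexp : ∀ x : ℂ, (Real.exp (-‖x‖ ^ 2 / 2) : ℂ) =
      Complex.exp (-(1 / 2) * (x * (starRingEnd ℂ) x)) := fun x => by
    rw [Complex.mul_conj']; push_cast; ring_nf
  simp only [hexp]
  convert (((hasWirtingerAt_of_hasDerivAt (hasDerivAt_id z)).mul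
    (hasWirtingerAt_conj z)).const_mul (-(1 / 2))).cexp using 1 <;> simp <;> ring

theorem sqrt_succ_mul_one_div_sqrt_factorial_succ (n : ℕ) :
    (√(n + 1 : ℝ) : ℂ) * (1 / (√(n + 1).factorial : ℂ)) = 1 / (√n.factorial : ℂ) := by
  have hn : (√(n + 1 : ℝ) : ℂ) ≠ 0 := by
    exact_mod_cast (Real.sqrt_pos.2 n.cast_add_one_pos).ne'
  rw [Nat.factorial_succ, Nat.cast_mul, Real.sqrt_mul (by positivity)]
  push_cast
  field_simp

theorem natCast_succ_mul_one_div_sqrt_factorial_succ (n : ℕ) :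
    (n + 1 : ℂ) * (1 / (√(n + 1).factorial : ℂ)) = √(n + 1 : ℝ) * (1 / (√n.factorial : ℂ)) := by
  have hsq : (√(n + 1 : ℝ) : ℂ) * √(n + 1 : ℝ) = n + 1 := by
    exact_mod_cast Real.mul_self_sqrt n.cast_add_one_pos.le
  rw [← sqrt_succ_mul_one_div_sqrt_factorial_succ n, ← hsq, mul_assoc]

/-- The terms with `z̄ / 2` and `-z / 2` cancel along the rays `t ↦ t w`. -/
theorem hasWirtingerAt_weightedLevel (hF : Differentiable ℂ F) (n : ℕ) (z : ℂ) :
    HasWirtingerAt (fun x => weightedLevel F x n)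
      (√(n + 1 : ℝ) * weightedLevel F z (n + 1) + (starRingEnd ℂ) z / 2 * weightedLevel F z n)
      (-(√n * weightedLevel F z (n - 1)) - z / 2 * weightedLevel F z n) z := by
  convert (hasWirtingerAt_exp_neg_norm_sq z).mul
    ((hasWirtingerAt_iterate_landauRaising hF n z).const_mul
      (1 / (√n.factorial : ℂ))) using 1
  · rfl
  · rw [weightedLevel, weightedLevel, iterate_landauRaising_succ hF,
      ← sqrt_succ_mul_one_div_sqrt_factorial_succ n]
    ring
  · obtain _ | n := n
    · simp [weightedLevel]; ring
    · rw [weightedLevel, weightedLevel, Nat.add_sub_cancel]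
      push_cast
      linear_combination Complex.exp (-‖z‖ ^ 2 / 2) * landauRaising^[n] F z *
        natCast_succ_mul_one_div_sqrt_factorial_succ n

theorem continuous_weightedLevel (hF : Differentiable ℂ F) (n : ℕ) :
    Continuous fun z => weightedLevel F z n :=
  continuous_iff_continuousAt.2 fun z =>
    HasFDerivAt.continuousAt (hasWirtingerAt_weightedLevel hF n z)

end WeightedLevel

/-- The mass `∑_{n < N} |uₙ|²` of the first `N` levels. -/
noncomputable def mass (u : ℕ → ℂ) (N : ℕ) : ℝ := ∑ n ∈ Finset.range N, ‖u n‖ ^ 2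

theorem mass_mono (u : ℕ → ℂ) : Monotone (mass u) := fun _ _ h =>
  Finset.sum_le_sum_of_subset_of_nonneg (Finset.range_mono h) fun _ _ _ => sq_nonneg _

theorem mass_nonneg (u : ℕ → ℂ) (N : ℕ) : 0 ≤ mass u N := Finset.sum_nonneg fun _ _ => sq_nonneg _

theorem mass_le_mul {u : ℕ → ℂ} {Q : ℝ} (h : ∀ n, ‖u n‖ ^ 2 ≤ Q) (N : ℕ) : mass u N ≤ Q * N := by
  simpa [mass, mul_comm] using Finset.sum_le_card_nsmul (Finset.range N) (fun n => ‖u n‖ ^ 2) Q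
    fun n _ => h n

/-- A solution of the ladder equations `gₙ' = w √(n+1) gₙ₊₁ - w̄ √n gₙ₋₁`, which for `n = 0` read
`g₀' = w g₁`. -/
def IsLadderFlow (w : ℂ) (g : ℝ → ℕ → ℂ) : Prop :=
  ∀ n t, HasDerivAt (fun s => g s n)
    (w * √(n + 1 : ℝ) * g t (n + 1) - (starRingEnd ℂ) w * √n * g t (n - 1)) t

theorem isLadderFlow_weightedLevel {F : ℂ → ℂ} (hF : Differentiable ℂ F) (w : ℂ) :
    IsLadderFlow w fun t => weightedLevel F (t * w) := fun n t => by
  convert (hasWirtingerAt_weightedLevel hF n (t * w)).hasDerivAt_comp_ofReal_mul using 1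
  simp only [map_mul, Complex.conj_ofReal]
  ring

/-- The rate at which mass flows from the levels `≥ n` to the levels `< n` along a ladder flow. -/
noncomputable def ladderFlux (w : ℂ) (u : ℕ → ℂ) (n : ℕ) : ℝ :=
  2 * √n * (w * u n * (starRingEnd ℂ) (u (n - 1))).re

theorem abs_ladderFlux_le (w : ℂ) (u : ℕ → ℂ) (n : ℕ) :
    |ladderFlux w u n| ≤ ‖w‖ * √n * (‖u n‖ ^ 2 + ‖u (n - 1)‖ ^ 2) := by
  have hre : |(w * u n * (starRingEnd ℂ) (u (n - 1))).re| ≤ ‖w‖ * (‖u n‖ * ‖u (n - 1)‖) := by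
    simpa [mul_assoc] using Complex.abs_re_le_norm (w * u n * (starRingEnd ℂ) (u (n - 1)))
  calc |ladderFlux w u n|
      = √n * (2 * |(w * u n * (starRingEnd ℂ) (u (n - 1))).re|) := by
        rw [ladderFlux, abs_mul, abs_of_nonneg (by positivity)]; ring
    _ ≤ √n * (2 * (‖w‖ * (‖u n‖ * ‖u (n - 1)‖))) := by gcongr
    _ = ‖w‖ * √n * (2 * ‖u n‖ * ‖u (n - 1)‖) := by ring
    _ ≤ ‖w‖ * √n * (‖u n‖ ^ 2 + ‖u (n - 1)‖ ^ 2) := by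
        gcongr; exact two_mul_le_add_sq _ _

theorem sum_abs_ladderFlux_le (w : ℂ) (u : ℕ → ℂ) (P : ℕ) :
    ∑ n ∈ Finset.range P, |ladderFlux w u n| ≤ 2 * ‖w‖ * √P * mass u P := by
  obtain _ | P := P
  · simp [mass]
  have hshift : ∑ n ∈ Finset.range P, ‖u (n + 1)‖ ^ 2 ≤ mass u (P + 1) := by
    rw [mass, Finset.sum_range_succ']
    exact le_add_of_nonneg_right (sq_nonneg _)
  calc ∑ n ∈ Finset.range (P + 1), |ladderFlux w u n|
      = ∑ n ∈ Finset.range P, |ladderFlux w u (n + 1)| := by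
        rw [Finset.sum_range_succ']; simp [ladderFlux]
    _ ≤ ∑ n ∈ Finset.range P, ‖w‖ * √(P + 1 : ℕ) * (‖u (n + 1)‖ ^ 2 + ‖u n‖ ^ 2) := by
        refine Finset.sum_le_sum fun n hn => (abs_ladderFlux_le w u (n + 1)).trans ?_
        rw [Nat.add_sub_cancel]
        gcongr
        exact (Finset.mem_range.1 hn).le
    _ = ‖w‖ * √(P + 1 : ℕ) * (∑ n ∈ Finset.range P, ‖u (n + 1)‖ ^ 2 + mass u P) := by
        rw [← Finset.mul_sum, Finset.sum_add_distrib, mass]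
    _ ≤ ‖w‖ * √(P + 1 : ℕ) * (mass u (P + 1) + mass u (P + 1)) := by
        gcongr; exact mass_mono u P.le_succ
    _ = 2 * ‖w‖ * √(P + 1 : ℕ) * mass u (P + 1) := by ring

namespace IsLadderFlow

variable {w : ℂ} {g : ℝ → ℕ → ℂ}

theorem hasDerivAt_norm_sq (hg : IsLadderFlow w g) (n : ℕ) (t : ℝ) :
    HasDerivAt (fun s => ‖g s n‖ ^ 2) (ladderFlux w (g t) (n + 1) - ladderFlux w (g t) n) t := by
  refine (hg n t).norm_sq.congr_deriv ?_
  simp [ladderFlux, Complex.inner]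
  ring

theorem hasDerivAt_mass (hg : IsLadderFlow w g) (N : ℕ) (t : ℝ) :
    HasDerivAt (fun s => mass (g s) N) (ladderFlux w (g t) N) t := by
  refine (HasDerivAt.fun_sum fun n (_ : n ∈ Finset.range N) =>
    hg.hasDerivAt_norm_sq n t).congr_deriv ?_
  rw [Finset.sum_range_sub]
  simp [ladderFlux]

theorem window_mass_le (hg : IsLadderFlow w g) {C : ℝ} {N P : ℕ} (hNP : N ≤ P)
    (hC : ∀ r ∈ Set.Icc (0 : ℝ) 1, mass (g r) P ≤ C) {s t : ℝ} (hs : s ∈ Set.Icc (0 : ℝ) 1)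
    (ht : t ∈ Set.Icc (0 : ℝ) 1) :
    (P - N) * mass (g s) N ≤ (P - N) * mass (g t) P + 2 * ‖w‖ * √P * C := by
  set window : ℝ → ℝ := fun r => ∑ n ∈ Finset.Ico N P, mass (g r) n
  have hC0 : 0 ≤ C := (mass_nonneg _ _).trans (hC s hs)
  have hderiv : ∀ r, HasDerivAt window (∑ n ∈ Finset.Ico N P, ladderFlux w (g r) n) r := fun r =>
    HasDerivAt.fun_sum fun n _ => hg.hasDerivAt_mass n r
  have hbound : ∀ r ∈ Set.Icc (0 : ℝ) 1,
      ‖∑ n ∈ Finset.Ico N P, ladderFlux w (g r) n‖ ≤ 2 * ‖w‖ * √P * C := fun r hr =>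
    calc ‖∑ n ∈ Finset.Ico N P, ladderFlux w (g r) n‖
        ≤ ∑ n ∈ Finset.Ico N P, |ladderFlux w (g r) n| := norm_sum_le _ _
      _ ≤ ∑ n ∈ Finset.range P, |ladderFlux w (g r) n| := by
          rw [Finset.range_eq_Ico]
          exact Finset.sum_le_sum_of_subset_of_nonneg (Finset.Ico_subset_Ico_left N.zero_le)
            fun _ _ _ => abs_nonneg _
      _ ≤ 2 * ‖w‖ * √P * mass (g r) P := sum_abs_ladderFlux_le w (g r) P
      _ ≤ 2 * ‖w‖ * √P * C := by gcongr; exact hC r hr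
  have hchange : window s - window t ≤ 2 * ‖w‖ * √P * C := by
    refine (le_abs_self _).trans (((convex_Icc 0 1).norm_image_sub_le_of_norm_hasDerivWithin_le
      (fun r _ => (hderiv r).hasDerivWithinAt) hbound ht hs).trans ?_)
    exact mul_le_of_le_one_right (by positivity)
      (abs_le.2 ⟨by linarith [hs.1, ht.2], by linarith [hs.2, ht.1]⟩)
  have hlower : (P - N) * mass (g s) N ≤ window s := by
    simpa [Nat.cast_sub hNP] using Finset.card_nsmul_le_sum (Finset.Ico N P) (mass (g s)) _
      fun n hn => mass_mono _ (Finset.mem_Ico.1 hn).1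
  have hupper : window t ≤ (P - N) * mass (g t) P := by
    simpa [Nat.cast_sub hNP] using Finset.sum_le_card_nsmul (Finset.Ico N P) (mass (g t)) _
      fun n hn => mass_mono _ (Finset.mem_Ico.1 hn).2.le
  linarith

/-- The window from `N` to `2 N` turns a crude linear bound on the mass into one with half the
constant, up to the constant of the initial mass. -/
theorem mass_le_of_mass_le (hg : IsLadderFlow w g) {B D : ℝ} (hB : ∀ n, mass (g 0) n ≤ B * n)
    (hD : ∀ n : ℕ, 128 * ‖w‖ ^ 2 ≤ n → ∀ r ∈ Set.Icc (0 : ℝ) 1, mass (g r) n ≤ D * n) {N : ℕ}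
    (hN : 128 * ‖w‖ ^ 2 ≤ N) {t : ℝ} (ht : t ∈ Set.Icc (0 : ℝ) 1) :
    mass (g t) N ≤ (2 * B + D / 2) * N := by
  obtain rfl | hpos := N.eq_zero_or_pos
  · simp [mass]
  have hNpos : (0 : ℝ) < N := Nat.cast_pos.2 hpos
  have hmass := hD (2 * N) (by push_cast; linarith)
  have hDN : 0 ≤ D * (2 * N : ℕ) := (mass_nonneg _ _).trans (hmass t ht)
  have hsqrt : 8 * ‖w‖ * √(2 * N : ℕ) ≤ N := by
    refine abs_le_of_sq_le_sq' ?_ hNpos.le |>.2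
    rw [mul_pow, Real.sq_sqrt (Nat.cast_nonneg _)]
    push_cast
    nlinarith
  have hwindow := hg.window_mass_le (Nat.le_mul_of_pos_left N two_pos) hmass ht
    (Set.left_mem_Icc.2 zero_le_one)
  have herror : 2 * ‖w‖ * √(2 * N : ℕ) * (D * (2 * N : ℕ)) ≤ N / 4 * (D * (2 * N : ℕ)) := by
    gcongr; linarith
  have hinit := mul_le_mul_of_nonneg_left (hB (2 * N)) hNpos.le
  push_cast at hwindow herror hinit hDN
  refine le_of_mul_le_mul_left ?_ hNpos
  linarith

theorem mass_le (hg : IsLadderFlow w g) {B Q : ℝ} (hB : ∀ n, mass (g 0) n ≤ B * n)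
    (hQ : ∀ n, ∀ r ∈ Set.Icc (0 : ℝ) 1, ‖g r n‖ ^ 2 ≤ Q) {N : ℕ} (hN : 128 * ‖w‖ ^ 2 ≤ N)
    {t : ℝ} (ht : t ∈ Set.Icc (0 : ℝ) 1) : mass (g t) N ≤ 4 * B * N := by
  have hB0 : 0 ≤ B := by simpa using (mass_nonneg _ _).trans (hB 1)
  have hiter : ∀ k : ℕ, ∀ n : ℕ, 128 * ‖w‖ ^ 2 ≤ n → ∀ r ∈ Set.Icc (0 : ℝ) 1,
      mass (g r) n ≤ (4 * B + Q / 2 ^ k) * n := by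
    intro k
    induction k with
    | zero =>
      intro n _ r hr
      refine (mass_le_mul (fun m => hQ m r hr) n).trans ?_
      gcongr
      linarith
    | succ k ih =>
      intro n hn r hr
      refine (hg.mass_le_of_mass_le hB ih hn hr).trans_eq ?_
      rw [pow_succ]
      ring
  have hlim : Tendsto (fun k : ℕ => (4 * B + Q / 2 ^ k) * N) atTop (𝓝 (4 * B * N)) := by
    simpa [div_eq_mul_inv] using ((tendsto_inv_atTop_zero.comp
      (tendsto_pow_atTop_atTop_of_one_lt one_lt_two)).const_mul Q).const_add (4 * B) |>.mul_const _
  exact ge_of_tendsto' hlim fun k => hiter k N hN t ht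

end IsLadderFlow

/-- The sum of the first `L` terms of the Taylor series of `F` at `0`. -/
noncomputable def taylorSum (F : ℂ → ℂ) (L : ℕ) (z : ℂ) : ℂ :=
  ∑ n ∈ Finset.range L, (n.factorial : ℂ)⁻¹ * iteratedDeriv n F 0 * z ^ n

section TaylorSum

variable {F : ℂ → ℂ}

theorem taylorSum_zero (F : ℂ → ℂ) : taylorSum F 0 = 0 := by
  ext
  simp [taylorSum]

theorem differentiable_taylorSum (F : ℂ → ℂ) (L : ℕ) : Differentiable ℂ (taylorSum F L) := by
  unfold taylorSum
  fun_prop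

theorem deriv_taylorSum_succ (F : ℂ → ℂ) (L : ℕ) :
    deriv (taylorSum F (L + 1)) = taylorSum (deriv F) L := by
  ext z
  have hderiv := HasDerivAt.fun_sum fun n (_ : n ∈ Finset.range (L + 1)) =>
    (hasDerivAt_pow n z).const_mul ((n.factorial : ℂ)⁻¹ * iteratedDeriv n F 0)
  refine hderiv.deriv.trans ?_
  rw [Finset.sum_range_succ', taylorSum]
  simp only [Nat.cast_zero, zero_mul, mul_zero, add_zero, Nat.add_sub_cancel, iteratedDeriv_succ']
  refine Finset.sum_congr rfl fun n _ => ?_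
  have := n.cast_add_one_ne_zero (R := ℂ)
  rw [Nat.factorial_succ]
  push_cast
  field_simp

theorem tendsto_taylorSum (hF : Differentiable ℂ F) (z : ℂ) :
    Tendsto (fun L => taylorSum F L z) atTop (𝓝 (F z)) := by
  refine (Complex.hasSum_taylorSeries_of_entire hF 0 z).tendsto_sum_nat.congr fun L =>
    Finset.sum_congr rfl fun n _ => ?_
  simp only [sub_zero, smul_eq_mul]
  ring

theorem tendsto_iterate_landauRaising_taylorSum (hF : Differentiable ℂ F) (n : ℕ) (z : ℂ) :
    Tendsto (fun L => landauRaising^[n] (taylorSum F L) z) atTop (𝓝 (landauRaising^[n] F z)) := by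
  induction n generalizing F with
  | zero => exact tendsto_taylorSum hF z
  | succ n ih =>
    rw [← tendsto_add_atTop_iff_nat 1, iterate_landauRaising_succ hF]
    simp only [iterate_landauRaising_succ (differentiable_taylorSum F _), deriv_taylorSum_succ]
    exact (ih hF.deriv).sub (((tendsto_add_atTop_iff_nat 1).2 (ih hF)).const_mul _)

theorem norm_iteratedDeriv_taylorSum_zero_le (F : ℂ → ℂ) (L n : ℕ) :
    ‖iteratedDeriv n (taylorSum F L) 0‖ ≤ ‖iteratedDeriv n F 0‖ := by
  induction n generalizing F L with
  | zero => obtain _ | L := L <;> simp [taylorSum, Finset.sum_range_succ']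
  | succ n ih =>
    obtain _ | L := L
    · simp [taylorSum_zero, Pi.zero_def]
    · simpa only [iteratedDeriv_succ', deriv_taylorSum_succ] using ih (deriv F) L

theorem iterate_landauRaising_zero_fun (n : ℕ) : landauRaising^[n] 0 = 0 := by
  refine Function.iterate_fixed ?_ n
  ext z
  simp [landauRaising, wirtingerDeriv]

theorem exists_norm_iterate_landauRaising_taylorSum_le (F : ℂ → ℂ) (L : ℕ) {R : ℝ} (hR : 0 ≤ R) :
    ∃ C, 0 ≤ C ∧ ∀ n z, ‖z‖ ≤ R → ‖landauRaising^[n] (taylorSum F L) z‖ ≤ C * (1 + R) ^ n := by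
  induction L generalizing F with
  | zero => exact ⟨0, le_rfl, by simp [taylorSum_zero, iterate_landauRaising_zero_fun]⟩
  | succ L ih =>
    obtain ⟨C, hC, hderiv⟩ := ih (deriv F)
    have hG := differentiable_taylorSum F (L + 1)
    obtain ⟨C', hG0⟩ := (isCompact_closedBall (0 : ℂ) R).exists_bound_of_continuousOn
      hG.continuous.continuousOn
    refine ⟨max C C', hC.trans (le_max_left _ _), fun n z hz => ?_⟩
    induction n with
    | zero => simpa using Or.inr (hG0 z (by simpa using hz))
    | succ n ihn =>
      have hn := (hderiv n z hz).trans
        (mul_le_mul_of_nonneg_right (le_max_left C C') (by positivity))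
      rw [iterate_landauRaising_succ hG, deriv_taylorSum_succ]
      calc _ ≤ _ := norm_sub_le _ _
        _ ≤ max C C' * (1 + R) ^ n + R * (max C C' * (1 + R) ^ n) := by
          rw [norm_mul, Complex.norm_conj]
          gcongr
        _ = max C C' * (1 + R) ^ (n + 1) := by ring

theorem pow_div_sqrt_factorial_le {x : ℝ} (hx : 0 ≤ x) (n : ℕ) :
    x ^ n / √n.factorial ≤ Real.exp (x ^ 2 / 2) := by
  have h := Real.sqrt_le_sqrt (Real.pow_div_factorial_le_exp (x ^ 2) (sq_nonneg x) n)
  rwa [Real.sqrt_div (by positivity), ← pow_mul, mul_comm, pow_mul,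
    Real.sqrt_sq (pow_nonneg hx n), ← Real.exp_half] at h

theorem exists_norm_weightedLevel_taylorSum_le (F : ℂ → ℂ) (L : ℕ) {R : ℝ} (hR : 0 ≤ R) :
    ∃ C, ∀ n z, ‖z‖ ≤ R → ‖weightedLevel (taylorSum F L) z n‖ ≤ C := by
  obtain ⟨C, hC, h⟩ := exists_norm_iterate_landauRaising_taylorSum_le F L hR
  refine ⟨C * Real.exp ((1 + R) ^ 2 / 2), fun n z hz => ?_⟩
  calc ‖weightedLevel (taylorSum F L) z n‖
      ≤ ‖landauRaising^[n] (taylorSum F L) z‖ / √n.factorial := norm_weightedLevel_le _ _ _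
    _ ≤ C * (1 + R) ^ n / √n.factorial := by gcongr; exact h n z hz
    _ = C * ((1 + R) ^ n / √n.factorial) := mul_div_assoc _ _ _
    _ ≤ C * Real.exp ((1 + R) ^ 2 / 2) := by
        gcongr; exact pow_div_sqrt_factorial_le (by positivity) n

end TaylorSum

section MassComparison

variable {F : ℂ → ℂ} {B : ℝ}

theorem mass_weightedLevel_taylorSum_zero_le (hF : Differentiable ℂ F) (L N : ℕ) :
    mass (weightedLevel (taylorSum F L) 0) N ≤ mass (weightedLevel F 0) N := by
  refine Finset.sum_le_sum fun n _ => ?_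
  rw [norm_weightedLevel_zero, norm_weightedLevel_zero, iterate_landauRaising_apply_zero hF,
    iterate_landauRaising_apply_zero (differentiable_taylorSum F L)]
  gcongr
  exact norm_iteratedDeriv_taylorSum_zero_le F L n

theorem norm_ofReal_mul_le {t : ℝ} (ht : t ∈ Set.Icc (0 : ℝ) 1) (z : ℂ) : ‖t * z‖ ≤ ‖z‖ := by
  rw [norm_mul, Complex.norm_real, Real.norm_of_nonneg ht.1]
  exact mul_le_of_le_one_left (norm_nonneg z) ht.2

/-- Taylor polynomials have bounded levels, which starts the iteration in `IsLadderFlow.mass_le`. -/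
theorem mass_weightedLevel_le (hF : Differentiable ℂ F)
    (hB : ∀ n, mass (weightedLevel F 0) n ≤ B * n) {z : ℂ} {N : ℕ} (hN : 128 * ‖z‖ ^ 2 ≤ N) :
    mass (weightedLevel F z) N ≤ 4 * B * N := by
  have hlim : Tendsto (fun L => mass (weightedLevel (taylorSum F L) z) N) atTop
      (𝓝 (mass (weightedLevel F z) N)) := tendsto_finsetSum _ fun n _ =>
    (((tendsto_iterate_landauRaising_taylorSum hF n z).const_mul _).const_mul _).norm.pow 2
  refine le_of_tendsto' hlim fun L => ?_
  obtain ⟨C, hC⟩ := exists_norm_weightedLevel_taylorSum_le F L (norm_nonneg z)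
  simpa using (isLadderFlow_weightedLevel (differentiable_taylorSum F L) z).mass_le
    (fun n => by simpa using (mass_weightedLevel_taylorSum_zero_le hF L n).trans (hB n))
    (fun n t ht => pow_le_pow_left₀ (norm_nonneg _) (hC n _ (norm_ofReal_mul_le ht z)) 2) hN
    (Set.right_mem_Icc.2 zero_le_one)

theorem window_mass_weightedLevel_le (hF : Differentiable ℂ F)
    (hB : ∀ n, mass (weightedLevel F 0) n ≤ B * n) {z : ℂ} {N P : ℕ} (hNP : N ≤ P)
    (hP : 128 * ‖z‖ ^ 2 ≤ P) {s t : ℝ} (hs : s ∈ Set.Icc (0 : ℝ) 1)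
    (ht : t ∈ Set.Icc (0 : ℝ) 1) :
    (P - N) * mass (weightedLevel F (s * z)) N ≤
      (P - N) * mass (weightedLevel F (t * z)) P + 8 * ‖z‖ * B * (√P * P) := by
  have hmass : ∀ r ∈ Set.Icc (0 : ℝ) 1, mass (weightedLevel F (r * z)) P ≤ 4 * B * P := by
    intro r hr
    refine mass_weightedLevel_le hF hB (le_trans ?_ hP)
    gcongr
    exact norm_ofReal_mul_le hr z
  refine ((isLadderFlow_weightedLevel hF z).window_mass_le hNP hmass hs ht).trans_eq ?_
  ring

end MassComparison

section Tauberian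

/-- The window width `⌊N ^ (3 / 4)⌋` lies strictly between the orders `√N` and `N`. -/
theorem exists_window_width : ∃ M : ℕ → ℕ, (∀ N, M N ≤ N) ∧ (∀ᶠ N in atTop, 0 < M N) ∧
    Tendsto (fun N => (M N / N : ℝ)) atTop (𝓝 0) ∧
    Tendsto (fun N : ℕ => √N / M N) atTop (𝓝 0) := by
  have hpow : Tendsto (fun N : ℕ => (N : ℝ) ^ (3 / 4 : ℝ)) atTop atTop :=
    (tendsto_rpow_atTop (by norm_num)).comp tendsto_natCast_atTop_atTop
  have hsmall : Tendsto (fun N : ℕ => (N : ℝ) ^ (-(1 / 4) : ℝ)) atTop (𝓝 0) :=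
    (tendsto_rpow_neg_atTop (by norm_num)).comp tendsto_natCast_atTop_atTop
  have hfloor : Tendsto (fun N : ℕ => (⌊(N : ℝ) ^ (3 / 4 : ℝ)⌋₊ : ℝ) / (N : ℝ) ^ (3 / 4 : ℝ)) atTop
      (𝓝 1) := tendsto_nat_floor_div_atTop.comp hpow
  refine ⟨fun N => ⌊(N : ℝ) ^ (3 / 4 : ℝ)⌋₊, fun N => ?_,
    (tendsto_nat_floor_atTop.comp hpow).eventually_gt_atTop 0, ?_, ?_⟩
  · refine Nat.floor_le_of_le ?_
    obtain rfl | hN := N.eq_zero_or_pos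
    · simp
    · exact Real.rpow_le_self_of_one_le (mod_cast hN) (by norm_num)
  · refine (mul_zero (1 : ℝ) ▸ hfloor.mul hsmall).congr' ?_
    filter_upwards [eventually_gt_atTop 0] with N hN
    have hN' : (0 : ℝ) < N := Nat.cast_pos.2 hN
    have hexp : (N : ℝ) ^ (-(1 / 4) : ℝ) / (N : ℝ) ^ (3 / 4 : ℝ) = (N : ℝ)⁻¹ := by
      rw [← Real.rpow_sub hN', ← Real.rpow_neg_one]
      norm_num
    rw [div_mul_eq_mul_div, mul_div_assoc, hexp, ← div_eq_mul_inv]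
  · refine (mul_zero (1⁻¹ : ℝ) ▸ (hfloor.inv₀ one_ne_zero).mul hsmall).congr' ?_
    filter_upwards [eventually_gt_atTop 0] with N hN
    have hN' : (0 : ℝ) < N := Nat.cast_pos.2 hN
    rw [inv_div, div_mul_eq_mul_div, ← Real.rpow_add hN', Real.sqrt_eq_rpow]
    norm_num

variable {A : ℕ → ℝ} {m : ℝ}

theorem tendsto_comp_div_of_tendsto_div {s : ℕ → ℕ}
    (hA : Tendsto (fun n : ℕ => A n / n) atTop (𝓝 m))
    (hs : Tendsto (fun N : ℕ => (s N / N : ℝ)) atTop (𝓝 1)) :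
    Tendsto (fun N : ℕ => A (s N) / N) atTop (𝓝 m) := by
  have hcancel : ∀ᶠ N : ℕ in atTop, (N : ℝ) * (s N / N) = s N := by
    filter_upwards [eventually_ne_atTop 0] with N hN
    field_simp
  have hs_atTop : Tendsto s atTop atTop := tendsto_natCast_atTop_iff.1
    ((tendsto_natCast_atTop_atTop.atTop_mul_pos one_pos hs).congr' hcancel)
  refine (mul_one m ▸ (hA.comp hs_atTop).mul hs).congr' ?_
  filter_upwards [hs_atTop.eventually_ne_atTop 0] with N hN
  simp only [Function.comp_apply]
  field_simp

theorem div_le_div_add_of_window {x y c : ℝ} {M N P : ℕ} (hc : 0 ≤ c) (hM : 0 < M) (hN : 0 < N)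
    (hP : P ≤ 2 * N) (h : M * x ≤ M * y + c * (√P * P)) : x / N ≤ y / N + 4 * c * (√N / M) := by
  have hM' : (0 : ℝ) < M := Nat.cast_pos.2 hM
  have hN' : (0 : ℝ) < N := Nat.cast_pos.2 hN
  have hP' : (P : ℝ) ≤ 2 * N := mod_cast hP
  have hsqrt : √P ≤ 2 * √N := by
    rw [Real.sqrt_le_left (by positivity), mul_pow, Real.sq_sqrt hN'.le]
    linarith
  have herror : c * (√P * P) ≤ M * (4 * c * (√N / M) * N) :=
    calc c * (√P * P) ≤ c * (2 * √N * (2 * N)) := by gcongr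
      _ = M * (4 * c * (√N / M) * N) := by field_simp; ring
  rw [div_add' _ _ _ hN'.ne']
  gcongr
  refine le_of_mul_le_mul_left ?_ hM'
  linarith

theorem tendstoUniformlyOn_div_of_window {ι : Type*} {K : Set ι} {T : ι → ℕ → ℝ} {c : ℝ}
    {n₀ : ℕ} (hA : Tendsto (fun n : ℕ => A n / n) atTop (𝓝 m)) (hc : 0 ≤ c)
    (hupper : ∀ z ∈ K, ∀ N P : ℕ, N ≤ P → n₀ ≤ P →
      (P - N) * T z N ≤ (P - N) * A P + c * (√P * P))
    (hlower : ∀ z ∈ K, ∀ N P : ℕ, N ≤ P → n₀ ≤ P →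
      (P - N) * A N ≤ (P - N) * T z P + c * (√P * P)) :
    TendstoUniformlyOn (fun (N : ℕ) z => T z N / N) (fun _ => m) atTop K := by
  obtain ⟨M, hMN, hMpos, hM, hsqrt⟩ := exists_window_width
  have hcancel : ∀ᶠ N : ℕ in atTop, (N / N : ℝ) = 1 := by
    filter_upwards [eventually_ne_atTop 0] with N hN using div_self (Nat.cast_ne_zero.2 hN)
  have hplus : Tendsto (fun N => ((N + M N : ℕ) / N : ℝ)) atTop (𝓝 1) := by
    refine (add_zero (1 : ℝ) ▸ hM.const_add 1).congr' (hcancel.mono fun N hN => ?_)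
    simp only [Nat.cast_add, add_div, hN]
  have hminus : Tendsto (fun N => ((N - M N : ℕ) / N : ℝ)) atTop (𝓝 1) := by
    refine (sub_zero (1 : ℝ) ▸ hM.const_sub 1).congr' (hcancel.mono fun N hN => ?_)
    simp only [Nat.cast_sub (hMN N), sub_div, hN]
  have herror : Tendsto (fun N : ℕ => 4 * c * (√N / M N)) atTop (𝓝 0) := by
    simpa using hsqrt.const_mul (4 * c)
  rw [← tendsto_prod_principal_iff]
  refine tendsto_of_tendsto_of_tendsto_of_le_of_le'
    ((sub_zero m ▸ (tendsto_comp_div_of_tendsto_div hA hminus).sub herror).comp tendsto_fst)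
    ((add_zero m ▸ (tendsto_comp_div_of_tendsto_div hA hplus).add herror).comp tendsto_fst) ?_ ?_
  all_goals
    rw [eventually_prod_principal_iff]
    filter_upwards [hMpos, eventually_ge_atTop n₀, eventually_gt_atTop 0] with N hpos hn₀ hN z hz
    simp only [Function.comp_apply, Function.HasUncurry.uncurry, id]
  · have h := hlower z hz (N - M N) N (Nat.sub_le _ _) hn₀
    rw [Nat.cast_sub (hMN N), sub_sub_cancel] at h
    exact sub_le_iff_le_add.2 (div_le_div_add_of_window hc hpos hN (by omega) h)
  · have h := hupper z hz N (N + M N) (Nat.le_add_right _ _) (by omega)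
    rw [Nat.cast_add, add_sub_cancel_left, ← Nat.cast_add] at h
    exact div_le_div_add_of_window hc hpos hN (by linarith [hMN N]) h

end Tauberian

section Deterministic

variable {F : ℂ → ℂ} {m : ℝ}

theorem exists_mass_le_mul {u : ℕ → ℂ}
    (h : Tendsto (fun N : ℕ => mass u N / N) atTop (𝓝 m)) : ∃ B, ∀ N, mass u N ≤ B * N := by
  obtain ⟨B, hB⟩ := h.bddAbove_range
  refine ⟨B, fun N => ?_⟩
  obtain rfl | hN := N.eq_zero_or_pos
  · simp [mass]
  · exact (div_le_iff₀ (Nat.cast_pos.2 hN)).1 (hB (Set.mem_range_self N))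

theorem tendstoUniformlyOn_mass_weightedLevel_div (hF : Differentiable ℂ F)
    (h : Tendsto (fun N : ℕ => mass (weightedLevel F 0) N / N) atTop (𝓝 m)) {K : Set ℂ}
    (hK : Bornology.IsBounded K) :
    TendstoUniformlyOn (fun (N : ℕ) z => mass (weightedLevel F z) N / N) (fun _ => m) atTop K := by
  obtain ⟨B, hB⟩ := exists_mass_le_mul h
  obtain ⟨R, hR, hKR⟩ := hK.exists_pos_norm_le
  obtain ⟨n₀, hn₀⟩ := exists_nat_ge (128 * R ^ 2)
  have hB0 : 0 ≤ B := by simpa using (mass_nonneg _ _).trans (hB 1)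
  have hwindow : ∀ z ∈ K, ∀ N P : ℕ, N ≤ P → n₀ ≤ P → ∀ s ∈ Set.Icc (0 : ℝ) 1,
      ∀ t ∈ Set.Icc (0 : ℝ) 1, (P - N) * mass (weightedLevel F (s * z)) N ≤
        (P - N) * mass (weightedLevel F (t * z)) P + 8 * R * B * (√P * P) := by
    intro z hz N P hNP hP s hs t ht
    have hzR : ‖z‖ ≤ R := hKR z hz
    have hP' : 128 * ‖z‖ ^ 2 ≤ (P : ℝ) :=
      calc 128 * ‖z‖ ^ 2 ≤ 128 * R ^ 2 := by gcongr
        _ ≤ (n₀ : ℝ) := hn₀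
        _ ≤ (P : ℝ) := Nat.cast_le.2 hP
    exact (window_mass_weightedLevel_le hF hB hNP hP' hs ht).trans (by gcongr)
  have h0 : (0 : ℝ) ∈ Set.Icc (0 : ℝ) 1 := Set.left_mem_Icc.2 zero_le_one
  have h1 : (1 : ℝ) ∈ Set.Icc (0 : ℝ) 1 := Set.right_mem_Icc.2 zero_le_one
  refine tendstoUniformlyOn_div_of_window h (c := 8 * R * B) (n₀ := n₀) (by positivity)
    (fun z hz N P hNP hP => ?_) fun z hz N P hNP hP => ?_
  · simpa using hwindow z hz N P hNP hP 1 h1 0 h0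
  · simpa using hwindow z hz N P hNP hP 0 h0 1 h1

theorem tendstoLocallyUniformly_mass_weightedLevel_div (hF : Differentiable ℂ F)
    (h : Tendsto (fun N : ℕ => mass (weightedLevel F 0) N / N) atTop (𝓝 m)) :
    TendstoLocallyUniformly (fun (N : ℕ) z => mass (weightedLevel F z) N / N) (fun _ => m)
      atTop :=
  tendstoLocallyUniformly_iff_forall_isCompact.2 fun _ hK =>
    tendstoUniformlyOn_mass_weightedLevel_div hF h hK.isBounded

end Deterministic

section GefSeries

open FormalMultilinearSeries

variable {a : ℕ → ℂ} {B D : ℝ}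

theorem isBigO_two_pow_of_mass_le (h : ∀ n, mass a n ≤ B * n) :
    a =O[atTop] fun k => (2 : ℝ) ^ k := by
  have hB : 0 ≤ B := by simpa using (mass_nonneg _ _).trans (h 1)
  refine Asymptotics.IsBigO.of_bound (B + 1) (Eventually.of_forall fun k => ?_)
  have hle : ‖a k‖ ^ 2 ≤ B * 2 ^ k :=
    calc ‖a k‖ ^ 2 ≤ mass a (k + 1) :=
          Finset.single_le_sum (f := fun n => ‖a n‖ ^ 2) (fun _ _ => sq_nonneg _)
            (Finset.self_mem_range_succ k)
      _ ≤ B * (k + 1 : ℕ) := h (k + 1)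
      _ ≤ B * 2 ^ k := by gcongr; exact_mod_cast Nat.lt_two_pow_self (n := k)
  have hone : (1 : ℝ) ≤ 2 ^ k := one_le_pow₀ one_le_two
  rw [Real.norm_of_nonneg (by positivity)]
  nlinarith [sq_nonneg (‖a k‖ - 1)]

theorem hasFPowerSeriesOnBall_gefSeries (ha : a =O[atTop] fun k => D ^ k) :
    HasFPowerSeriesOnBall (gefSeries a) (ofScalars ℂ fun k => a k / √k.factorial) 0 ⊤ := by
  have hradius : (ofScalars ℂ fun k => a k / (√k.factorial : ℂ)).radius = ⊤ := by
    refine radius_eq_top_of_forall_nnreal_isBigO _ fun r => ?_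
    have hbounded : (fun k : ℕ => D ^ k * (r ^ k / √k.factorial)) =O[atTop] fun _ => (1 : ℝ) := by
      refine Asymptotics.IsBigO.of_bound (Real.exp ((|D| * r) ^ 2 / 2))
        (Eventually.of_forall fun k => ?_)
      simpa [mul_pow, mul_div_assoc, abs_of_nonneg] using
        pow_div_sqrt_factorial_le (x := |D| * r) (by positivity) k
    refine ((ha.norm_left.mul (Asymptotics.isBigO_refl _ _)).trans hbounded).congr_left fun k => ?_
    rw [ofScalars_norm, norm_div, Complex.norm_real, Real.norm_of_nonneg (Real.sqrt_nonneg _)]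
    ring
  have h := (ofScalars ℂ fun k => a k / (√k.factorial : ℂ)).hasFPowerSeriesOnBall
    (hradius ▸ ENNReal.zero_lt_top)
  rw [hradius] at h
  convert h using 1
  ext z
  refine tsum_congr fun k => ?_
  rw [ofScalars_apply_eq, smul_eq_mul]
  ring

theorem differentiable_gefSeries (ha : a =O[atTop] fun k => D ^ k) :
    Differentiable ℂ (gefSeries a) := by
  have h := (hasFPowerSeriesOnBall_gefSeries ha).differentiableOn
  rwa [Metric.eball_top, differentiableOn_univ] at h

theorem iteratedDeriv_gefSeries_zero (ha : a =O[atTop] fun k => D ^ k) (n : ℕ) :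
    iteratedDeriv n (gefSeries a) 0 = √n.factorial * a n := by
  have h := (hasFPowerSeriesOnBall_gefSeries ha).hasFPowerSeriesAt
  have hcoeff := h.analyticAt.hasFPowerSeriesAt.eq_formalMultilinearSeries h
  rw [ofScalars_series_eq_iff] at hcoeff
  have hn := congrFun hcoeff n
  have hfact : (n.factorial : ℂ) = √n.factorial * √n.factorial := by
    exact_mod_cast (Real.mul_self_sqrt (Nat.cast_nonneg _)).symm
  have hsqrt : (√n.factorial : ℂ) ≠ 0 := by
    exact_mod_cast (Real.sqrt_pos.2 (Nat.cast_pos.2 n.factorial_pos)).ne'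
  rw [hfact] at hn
  field_simp at hn
  exact hn

theorem weightedLevel_gefSeries_zero (ha : a =O[atTop] fun k => D ^ k) :
    weightedLevel (gefSeries a) 0 = a := by
  ext n
  have hsqrt : (√n.factorial : ℂ) ≠ 0 := by
    exact_mod_cast (Real.sqrt_pos.2 (Nat.cast_pos.2 n.factorial_pos)).ne'
  rw [weightedLevel, iterate_landauRaising_apply_zero (differentiable_gefSeries ha),
    iteratedDeriv_gefSeries_zero ha]
  simp [hsqrt]

theorem averagedField_eq_mass_div (a : ℕ → ℂ) (N : ℕ) (z : ℂ) :
    averagedField a N z = mass (weightedLevel (gefSeries a) z) N / N :=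
  one_div_mul_eq_div _ _

theorem continuous_averagedField (ha : a =O[atTop] fun k => D ^ k) (N : ℕ) :
    Continuous (averagedField a N) :=
  (continuous_finsetSum _ fun n _ =>
    (continuous_weightedLevel (differentiable_gefSeries ha) n).norm.pow 2).const_mul _

theorem tendstoLocallyUniformly_averagedField {m : ℝ}
    (h : Tendsto (fun N : ℕ => mass a N / N) atTop (𝓝 m)) :
    (∀ N, Continuous (averagedField a N)) ∧
      TendstoLocallyUniformly (averagedField a) (fun _ => m) atTop := by
  obtain ⟨B, hB⟩ := exists_mass_le_mul h
  have ha := isBigO_two_pow_of_mass_le hB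
  refine ⟨continuous_averagedField ha, ?_⟩
  rw [← weightedLevel_gefSeries_zero ha] at h
  simpa only [← averagedField_eq_mass_div] using
    tendstoLocallyUniformly_mass_weightedLevel_div (differentiable_gefSeries ha) h

end GefSeries

section Probability

theorem integrable_sq_gaussianReal (v : NNReal) :
    Integrable (fun x : ℝ => x ^ 2) (gaussianReal 0 v) := by
  simpa using (memLp_id_gaussianReal (μ := 0) (v := v) 2).integrable_sq

theorem integral_sq_gaussianReal (v : NNReal) : ∫ x, x ^ 2 ∂(gaussianReal 0 v) = v := by
  have h := variance_fun_id_gaussianReal (μ := 0) (v := v)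
  rwa [variance_of_integral_eq_zero (by fun_prop) (by simp)] at h

theorem norm_sq_add_mul_I (x y : ℝ) : ‖(x : ℂ) + y * Complex.I‖ ^ 2 = x ^ 2 + y ^ 2 := by
  rw [Complex.sq_norm, Complex.normSq_add_mul_I]

theorem memLp_id_stdComplexGaussian : MemLp id 2 stdComplexGaussian := by
  rw [memLp_two_iff_integrable_sq_norm aestronglyMeasurable_id, stdComplexGaussian,
    integrable_map_measure (by fun_prop) (by fun_prop)]
  simp only [Function.comp_def, id, norm_sq_add_mul_I]
  exact ((integrable_sq_gaussianReal _).comp_fst _).add ((integrable_sq_gaussianReal _).comp_snd _)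

theorem integral_norm_sq_stdComplexGaussian : ∫ z, ‖z‖ ^ 2 ∂stdComplexGaussian = 1 := by
  rw [stdComplexGaussian, integral_map (by fun_prop) (by fun_prop)]
  simp only [norm_sq_add_mul_I]
  rw [integral_add ((integrable_sq_gaussianReal _).comp_fst _)
    ((integrable_sq_gaussianReal _).comp_snd _),
    integral_fun_fst (fun x : ℝ => x ^ 2), integral_fun_snd (fun x : ℝ => x ^ 2)]
  simp only [integral_sq_gaussianReal]
  norm_num

variable {Ω : Type*} [MeasurableSpace Ω] {P : Measure Ω}

theorem memLp_of_hasLaw_stdComplexGaussian {X : Ω → ℂ} (h : HasLaw X stdComplexGaussian P) :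
    MemLp X 2 P :=
  (h.map_eq ▸ memLp_id_stdComplexGaussian : MemLp id 2 (P.map X)).comp_of_map h.aemeasurable

theorem integral_norm_sq_of_hasLaw_stdComplexGaussian {X : Ω → ℂ}
    (h : HasLaw X stdComplexGaussian P) : ∫ ω, ‖X ω‖ ^ 2 ∂P = 1 := by
  rw [← integral_norm_sq_stdComplexGaussian]
  exact h.integral_comp (f := fun z => ‖z‖ ^ 2) (by fun_prop)

theorem ae_tendsto_mass_div {ζ : ℕ → Ω → ℂ} (hL2 : MemLp (ζ 0) 2 P)
    (hindep : Pairwise fun i j => ζ i ⟂ᵢ[P] ζ j) (hident : ∀ k, IdentDistrib (ζ k) (ζ 0) P P) :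
    ∀ᵐ ω ∂P, Tendsto (fun N : ℕ => mass (fun k => ζ k ω) N / N) atTop
      (𝓝 (∫ ω, ‖ζ 0 ω‖ ^ 2 ∂P)) :=
  have hsq : Measurable fun z : ℂ => ‖z‖ ^ 2 := by fun_prop
  strong_law_ae_real (fun k ω => ‖ζ k ω‖ ^ 2) hL2.norm.integrable_sq
    (fun _ _ hij => (hindep hij).comp hsq hsq) fun k => (hident k).comp hsq

end Probability

theorem theorem2p3_general {Ω : Type*} [MeasurableSpace Ω] {P : Measure Ω} {ζ : ℕ → Ω → ℂ}
    (hL2 : MemLp (ζ 0) 2 P) (hindep : Pairwise fun i j => ζ i ⟂ᵢ[P] ζ j)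
    (hident : ∀ k, IdentDistrib (ζ k) (ζ 0) P P) :
    ∀ᵐ ω ∂P, (∀ N, Continuous (averagedField (fun k => ζ k ω) N)) ∧
      TendstoLocallyUniformly (averagedField fun k => ζ k ω)
        (fun _ => ∫ ω, ‖ζ 0 ω‖ ^ 2 ∂P) atTop :=
  (ae_tendsto_mass_div hL2 hindep hident).mono fun _ => tendstoLocallyUniformly_averagedField

theorem theorem2p3 {Ω : Type*} [MeasurableSpace Ω] (P : Measure Ω) [IsProbabilityMeasure P]
    (ζ : ℕ → Ω → ℂ) (hlaw : ∀ k, HasLaw (ζ k) stdComplexGaussian P) (hindep : iIndepFun ζ P)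
    (K : Set ℂ) (hK : IsCompact K) :
    ∀ᵐ ω ∂P,
      (∀ N : ℕ, ContinuousOn (averagedField (fun k => ζ k ω) N) K) ∧
      TendstoUniformlyOn (fun N : ℕ => averagedField (fun k => ζ k ω) N)
        (fun _ => (1 : ℝ)) atTop K := by
  filter_upwards [theorem2p3_general (memLp_of_hasLaw_stdComplexGaussian (hlaw 0))
    (fun _ _ hij => hindep.indepFun hij) fun k => (hlaw k).identDistrib (hlaw 0)]
    with ω ⟨hcont, hlim⟩
  rw [integral_norm_sq_of_hasLaw_stdComplexGaussian (hlaw 0)] at hlim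
  exact ⟨fun N => (hcont N).continuousOn, tendstoLocallyUniformly_iff_forall_isCompact.1 hlim K hK⟩
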